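/- Let $\mathsf{B}$ be the closed Euclidean unit ball of $\mathbb{R}^d$ and let $\mathsf{cg}(S)=\int_S x\,dx\big/\int_S 1\,dx$. There is an absolute constant $C>0$ such that the following holds for all integers $d\ge 1$ and $T\ge 2$. (1) Cutting planes. A point $w^*\in\mathsf{B}$ is hidden. In each round $t=1,\dots,T$ the learner queries a point $p_t$, and a strong separation oracle answers with a direction $v_t$, $\|v_t\|=1$, such that $\langle w^*,v_t\rangle\ge\langle p_t,v_t\rangle$; the direction $v_t$ may depend arbitrarily on $p_t$ and on the previous rounds. Put $K_1=\mathsf{B}$ and $K_{t+1}=K_t\cap\{w:\langle w-p_t,v_t\rangle\ge 0\}$. Then the algorithm that always queries $$p_t=\mathsf{cg}\Big(K_t+\tfrac1T\mathsf{B}\Big)$$ (Minkowski sum) only queries points of $\mathsf{B}$ and, for every $w^*\in\mathsf{B}$ and every such oracle, satisfies $$\sum_{t=1}^{T}\langle w^*-p_t,v_t\rangle\le C\,d\log T .$$ (2) Contextual recommendation. A point $w^*\in\mathsf{B}$ is hidden. In each round $t=1,\dots,T$ an adversary, who may take the previous rounds into account, offers a set of actions $\mathcal{X}_t\subseteq\mathsf{B}$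 such that $\mathsf{BR}_t(w)=\arg\max_{x\in\mathcal{X}_t}\langle x,w\rangle$ is nonempty for every $w\in\mathsf{B}$; the learner plays some $x_t\in\mathcal{X}_t$ and then sees an arbitrary element $x_t^*$ of $\mathsf{BR}_t(w^*)$. Let the learner run the algorithm of (1) as a subroutine: if $p$ is the current query point of the subroutine, play $x_t\in\mathsf{BR}_t(p)$, with ties broken by any fixed rule that depends only on $\mathcal{X}_t$ and $p$; if $x_t^*\ne x_t$, give the subroutine the answer $(x_t^*-x_t)/\|x_t^*-x_t\|$ to its query; if $x_t^*=x_t$, leave the state of the subroutine unchanged. Then, for every $w^*\in\mathsf{B}$ and every such adversary, $$\sum_{t=1}^{T}\langle x_t^*-x_t,w^*\rangle\le C\,d\log T .$$ -/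

import Mathlib

open scoped Pointwise InnerProductSpace

noncomputable section

namespace LowRegret

/-- The space `ℝ^d` with its Euclidean norm. -/
abbrev Vec (d : ℕ) : Type := EuclideanSpace ℝ (Fin d)

/-- The closed Euclidean unit ball of `ℝ^d`. -/
def unitBall (d : ℕ) : Set (Vec d) := {x | ‖x‖ ≤ 1}

/-- The center of gravity `(∫_S x dx) / (∫_S 1 dx)`, for Lebesgue measure. -/
def centroid {d : ℕ} (S : Set (Vec d)) : Vec d :=
  (MeasureTheory.volume.real S)⁻¹ • ∫ x in S, x

/-! ### Cutting-plane algorithms -/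

/-- What the learner has seen so far: the list of the past pairs (query point, direction returned
by the oracle), oldest first. -/
abbrev CutHistory (d : ℕ) : Type := List (Vec d × Vec d)

/-- A (deterministic) cutting-plane algorithm chooses the next query point from the history. -/
abbrev CutAlgorithm (d : ℕ) : Type := CutHistory d → Vec d

/-- The knowledge set: the points of the unit ball that lie in all halfspaces
`⟨w - p, v⟩ ≥ 0` returned so far. -/
def knowledgeSet {d : ℕ} (h : CutHistory d) : Set (Vec d) :=
  {w | w ∈ unitBall d ∧ ∀ a ∈ h, 0 ≤ ⟪w - a.1, a.2⟫_ℝ}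

/-- The algorithm (for time horizon `T`) that queries the centroid of `K + (1/T) B`, where `K` is
the current knowledge set and `B` the unit ball (Minkowski sum). -/
def centroidAlgorithm (d T : ℕ) : CutAlgorithm d :=
  fun h => centroid (knowledgeSet h + (1 / (T : ℝ)) • unitBall d)

/-- `v` is an admissible answer of a separation oracle with hidden point `w` to the query `p`. -/
def IsSeparatingAnswer {d : ℕ} (w p v : Vec d) : Prop :=
  ‖v‖ = 1 ∧ ⟪p, v⟫_ℝ ≤ ⟪w, v⟫_ℝ

/-- `p`, `v` is the transcript of `T` rounds (numbered `0, …, T - 1`) of the algorithm `A` against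
a strong separation oracle with hidden point `w`: in round `t`, the algorithm computes the query
`p t` from the previous rounds and the oracle answers with `v t`. Nothing but admissibility is
required of `v t`, so it may depend on `p t`, on the previous rounds, and on `A`. -/
structure IsCutRun {d : ℕ} (A : CutAlgorithm d) (w : Vec d) (T : ℕ) (p v : ℕ → Vec d) :
    Prop where
  query : ∀ t < T, p t = A ((List.range t).map fun s => (p s, v s))
  answer : ∀ t < T, IsSeparatingAnswer w (p t) (v t)

/-- Total regret of a transcript of a cutting-plane algorithm. -/
def cutRegret {d : ℕ} (w : Vec d) (T : ℕ) (p v : ℕ → Vec d) : ℝ :=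
  ∑ t ∈ Finset.range T, ⟪w - p t, v t⟫_ℝ

/-- Against every strong separation oracle and for every hidden point of the unit ball, the
algorithm `A` only queries points of the unit ball, and its total regret over `T` rounds is at
most `ρ`. -/
def CutRegretAtMost {d : ℕ} (A : CutAlgorithm d) (T : ℕ) (ρ : ℝ) : Prop :=
  ∀ w ∈ unitBall d, ∀ p v : ℕ → Vec d, IsCutRun A w T p v →
    (∀ t < T, p t ∈ unitBall d) ∧ cutRegret w T p v ≤ ρ

/-! ### Contextual recommendation -/

/-- The set of optimal actions of `X` for the hidden point `w`: the argmax of `⟨x, w⟩`, `x ∈ X`. -/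
def bestResponses {d : ℕ} (X : Set (Vec d)) (w : Vec d) : Set (Vec d) :=
  {x | x ∈ X ∧ ∀ y ∈ X, ⟪y, w⟫_ℝ ≤ ⟪x, w⟫_ℝ}

/-- The list of the past rounds, oldest first; a round consists of the set of actions offered,
the action played, and the best action returned as feedback. -/
abbrev RecHistory (d : ℕ) : Type := List (Set (Vec d) × Vec d × Vec d)

/-- A (deterministic) algorithm for contextual recommendation chooses the action from the past
rounds and the set of actions now offered. -/
abbrev RecAlgorithm (d : ℕ) : Type := RecHistory d → Set (Vec d) → Vec d

/-- A set of actions that may be offered: it lies in the unit ball, and `argmax_{x ∈ X} ⟨x, w⟩`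
is attained for each `w` in the unit ball (for example, `X` nonempty and finite or compact). -/
def IsActionSet {d : ℕ} (X : Set (Vec d)) : Prop :=
  X ⊆ unitBall d ∧ ∀ w ∈ unitBall d, (bestResponses X w).Nonempty

/-- `X`, `x`, `y` is the transcript of `T` rounds of the algorithm `R` with hidden point `w`: in
round `t`, the adversary offers `X t`, the algorithm plays `x t`, and the feedback is an arbitrary
best action `y t`. Nothing else is required of `X t` and `y t`, so they may depend on the previous
rounds and on `R`. -/
structure IsRecRun {d : ℕ} (R : RecAlgorithm d) (w : Vec d) (T : ℕ)
    (X : ℕ → Set (Vec d)) (x y : ℕ → Vec d) : Prop where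
  offer : ∀ t < T, IsActionSet (X t)
  play : ∀ t < T, x t = R ((List.range t).map fun s => (X s, x s, y s)) (X t)
  feedback : ∀ t < T, y t ∈ bestResponses (X t) w

/-- Total regret of a transcript of contextual recommendation. -/
def recRegret {d : ℕ} (w : Vec d) (T : ℕ) (x y : ℕ → Vec d) : ℝ :=
  ∑ t ∈ Finset.range T, ⟪y t - x t, w⟫_ℝ

/-- Against every adversary and for every hidden point of the unit ball, the algorithm `R` only
plays actions that are on offer, and its total regret over `T` rounds is at most `ρ`. -/
def RecRegretAtMost {d : ℕ} (R : RecAlgorithm d) (T : ℕ) (ρ : ℝ) : Prop :=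
  ∀ w ∈ unitBall d, ∀ (X : ℕ → Set (Vec d)) (x y : ℕ → Vec d), IsRecRun R w T X x y →
    (∀ t < T, x t ∈ X t) ∧ recRegret w T x y ≤ ρ

/-! ### From cutting planes to recommendation -/

/-- `br` selects a best response whenever there is one (it breaks the ties in the argmax). -/
def IsBestResponseSelector {d : ℕ} (br : Set (Vec d) → Vec d → Vec d) : Prop :=
  ∀ X w, (bestResponses X w).Nonempty → br X w ∈ bestResponses X w

open Classical in
/-- The history of the copy of the cutting-plane algorithm `A` that is simulated during a
recommendation game. A round in which the feedback `y` is the action `x` played is ignored;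
otherwise the query that `A` makes is answered with `(y - x) / ‖y - x‖`. -/
def simulatedHistory {d : ℕ} (A : CutAlgorithm d) (h : RecHistory d) : CutHistory d :=
  h.foldl (fun g a =>
    if a.2.2 = a.2.1 then g
    else g ++ [(A g, ‖a.2.2 - a.2.1‖⁻¹ • (a.2.2 - a.2.1))]) []

/-- The recommendation algorithm obtained from the cutting-plane algorithm `A`: play a best
response to the current query point of the simulated copy of `A`. -/
def recommendVia {d : ℕ} (br : Set (Vec d) → Vec d → Vec d) (A : CutAlgorithm d) :
    RecAlgorithm d :=
  fun h X => br X (A (simulatedHistory A h))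

end LowRegret

end

namespace LowRegret

open MeasureTheory Set
open scoped ENNReal

/-! ### The Prékopa–Leindler inequality for midpoints -/

/-! The proof is a volume argument. Let `S` be the knowledge set enlarged by `r = 1/T`. A cut
through the query `p` removes from `S` at least the part where `⟪x - p, v⟫ < -r`, since enlarging
crosses the cutting hyperplane by at most `r`. If the regret `⟪w - p, v⟫` of the round is at least
`20 d r`, that part has at least `1/16` of the volume (`volume_div_le_volume_below`). As `S` always
contains the ball of radius `r` around the hidden point, its log-volume decreases by at most about
`2 d log T` in all. Hence the large-regret rounds, each of regret at most 2, cost `O(d log T)`; the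
others cost at most `20 d / T` each, `20 d` in total.

The shifted Grünbaum inequality rests on two facts. Contracting `S` towards a point far above the
hyperplane shows that much of its mass lies well above, so by the centroid condition the negative
part of `⟪x - p, v⟫` has a large integral. Log-concavity, extracted from Prékopa–Leindler in
`integral_tail_mul_le`, shows that a small volume below level `-r` cannot carry that integral.

The queries stay in the unit ball by a reflection argument (`centroid_mem_unitBall`). Recommendation
reduces to cutting planes because the normalized difference of two best responses is a separating
direction, at the cost of a factor 2. -/

/-- One-dimensional Brunn–Minkowski inequality for compact sets. -/
lemma volume_add_volume_le_of_isCompact {K L C : Set ℝ} (hK : IsCompact K) (hL : IsCompact L)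
    (hK' : K.Nonempty) (hL' : L.Nonempty) (hC : ∀ a ∈ K, ∀ b ∈ L, (a + b) / 2 ∈ C) :
    volume K + volume L ≤ 2 * volume C := by
  obtain ⟨k, hkK, hk⟩ := hK.exists_isGreatest hK'
  obtain ⟨l, hlL, hl⟩ := hL.exists_isLeast hL'
  have hD : volume ((fun z : ℝ => z * (1 / 2)) ⁻¹' C) = 2 * volume C := by
    rw [Real.volume_preimage_mul_right (by norm_num)]
    norm_num
  -- These preimages are the translates `K + l` and `L + k`, both inside `2C`. Since `k` is the top
  -- of `K` and `l` the bottom of `L`, they meet at most in `k + l`.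
  have hK1 : volume ((fun z : ℝ => z + -l) ⁻¹' K) = volume K := measure_preimage_add_right _ _ _
  have hL1 : volume ((fun z : ℝ => z + -k) ⁻¹' L) = volume L := measure_preimage_add_right _ _ _
  have hinter : volume ((fun z : ℝ => z + -l) ⁻¹' K ∩ (fun z : ℝ => z + -k) ⁻¹' L) = 0 := by
    refine measure_mono_null (t := {k + l}) ?_ (by simp)
    rintro z ⟨h1, h2⟩
    have h3 := hk h1
    have h4 := hl h2
    simp only at h3 h4
    exact le_antisymm (by linarith) (by linarith)
  rw [← hD, ← hK1, ← hL1, ← measure_union_add_inter _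
    (measurable_add_const (-k) hL.measurableSet), hinter, add_zero]
  refine measure_mono ?_
  rintro z (hz | hz)
  · have := hC _ hz l hlL
    simp only [mem_preimage]
    convert this using 1
    ring
  · have := hC k hkK _ hz
    simp only [mem_preimage]
    convert this using 1
    ring

/-- One-dimensional Brunn–Minkowski inequality. -/
lemma volume_add_volume_le {A B C : Set ℝ} (hA : MeasurableSet A) (hB : MeasurableSet B)
    (hA' : A.Nonempty) (hB' : B.Nonempty) (hC : ∀ a ∈ A, ∀ b ∈ B, (a + b) / 2 ∈ C) :
    volume A + volume B ≤ 2 * volume C := by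
  obtain ⟨a, ha⟩ := hA'
  obtain ⟨b, hb⟩ := hB'
  have key : ∀ K ⊆ A, IsCompact K → ∀ L ⊆ B, IsCompact L →
      volume K + volume L ≤ 2 * volume C := by
    intro K hKA hK L hLB hL
    -- Adjoining `a` and `b` makes both compact sets nonempty, which the compact case needs.
    refine le_trans (add_le_add (measure_mono (subset_insert a K))
      (measure_mono (subset_insert b L))) ?_
    refine volume_add_volume_le_of_isCompact (hK.insert a) (hL.insert b) (insert_nonempty _ _)
      (insert_nonempty _ _) fun x hx y hy => hC x ?_ y ?_
    · exact insert_subset ha hKA hx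
    · exact insert_subset hb hLB hy
  rw [hA.measure_eq_iSup_isCompact, hB.measure_eq_iSup_isCompact]
  simp only [iSup_and']
  refine ENNReal.biSup_add_biSup_le' (p := fun K => K ⊆ A ∧ IsCompact K)
    (q := fun K => K ⊆ B ∧ IsCompact K) ⟨∅, empty_subset _, isCompact_empty⟩
    ⟨∅, empty_subset _, isCompact_empty⟩ ?_
  rintro K ⟨h1, h2⟩ L ⟨h3, h4⟩
  exact key K h1 h2 L h3 h4

/-- Layer-cake formula plus Brunn–Minkowski on superlevel sets. With both suprema equal to 1, the
sets `{f > t}` and `{g > t}` are both nonempty for `t < 1` and both empty for `t ≥ 1`; without this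
common height Brunn–Minkowski would fail at levels where just one is empty. -/
lemma lintegral_add_le_of_real {f g h : ℝ → ℝ} (hf : Measurable f) (hg : Measurable g)
    (hh : Measurable h) (hf0 : ∀ x, 0 ≤ f x) (hg0 : ∀ x, 0 ≤ g x) (hh0 : ∀ x, 0 ≤ h x)
    (hf1 : ∀ x, f x ≤ 1) (hg1 : ∀ x, g x ≤ 1) (hfs : ∀ t < 1, ∃ x, t < f x)
    (hgs : ∀ t < 1, ∃ x, t < g x) (H : ∀ x y, f x * g y ≤ h ((x + y) / 2) ^ 2) :
    (∫⁻ x, ENNReal.ofReal (f x)) + ∫⁻ x, ENNReal.ofReal (g x) ≤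
      2 * ∫⁻ x, ENNReal.ofReal (h x) := by
  have hmeas : ∀ u : ℝ → ℝ, Measurable fun t : ℝ => volume {a | t < u a} := fun u =>
    Antitone.measurable fun s t hst => measure_mono fun a (ha : t < u a) => lt_of_le_of_lt hst ha
  rw [lintegral_eq_lintegral_meas_lt _ (.of_forall hf0) hf.aemeasurable,
    lintegral_eq_lintegral_meas_lt _ (.of_forall hg0) hg.aemeasurable,
    lintegral_eq_lintegral_meas_lt _ (.of_forall hh0) hh.aemeasurable,
    ← lintegral_add_left (hmeas f), ← lintegral_const_mul _ (hmeas h)]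
  refine setLIntegral_mono' measurableSet_Ioi fun t ht => ?_
  rw [mem_Ioi] at ht
  rcases lt_or_ge t 1 with h1 | h1
  · refine volume_add_volume_le (measurableSet_lt measurable_const hf)
      (measurableSet_lt measurable_const hg) (hfs t h1) (hgs t h1) fun a ha b hb => ?_
    simp only [mem_ofPred_eq] at ha hb ⊢
    refine lt_of_pow_lt_pow_left₀ 2 (hh0 _) (lt_of_lt_of_le ?_ (H a b))
    rw [sq]
    exact mul_lt_mul'' ha hb ht.le ht.le
  · have e1 : {a | t < f a} = ∅ := by
      ext a; simpa using (hf1 a).trans h1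
    have e2 : {a | t < g a} = ∅ := by
      ext a; simpa using (hg1 a).trans h1
    simp [e1, e2]

lemma exists_mul_self_eq_ennreal (a : ℝ≥0∞) (ha : a ≠ 0) (ha' : a ≠ ∞) :
    ∃ c : ℝ≥0∞, c ≠ 0 ∧ c ≠ ∞ ∧ c * c = a := by
  have h : a ^ (1 / 2 : ℝ) * a ^ (1 / 2 : ℝ) = a := by
    rw [← ENNReal.rpow_add _ _ ha ha']
    norm_num
  refine ⟨_, ?_, ?_, h⟩
  · intro h0; rw [h0] at h; exact ha (by simpa using h.symm)
  · intro h0; rw [h0] at h; exact ha' (by simpa using h.symm)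

lemma four_mul_le_sq_add_ennreal (a b : ℝ≥0∞) : 4 * a * b ≤ (a + b) ^ 2 := by
  rcases eq_or_ne a ∞ with rfl | ha
  · simp
  rcases eq_or_ne b ∞ with rfl | hb
  · simp
  lift a to NNReal using ha
  lift b to NNReal using hb
  exact_mod_cast four_mul_le_sq_add a b

/-- Dividing `f`, `g` by their suprema `M`, `N` and `h` by `√(MN)` preserves the hypothesis and
gives the additive inequality; `4ab ≤ (a + b)²` turns it into the product form. -/
lemma prekopaLeindler_real_of_bounded {f g h : ℝ → ℝ≥0∞} (hf : Measurable f) (hg : Measurable g)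
    (hh : Measurable h) (hfb : ⨆ x, f x ≠ ∞) (hgb : ⨆ x, g x ≠ ∞)
    (H : ∀ x y, f x * g y ≤ h ((x + y) / 2) ^ 2) :
    (∫⁻ x, f x) * ∫⁻ x, g x ≤ (∫⁻ x, h x) ^ 2 := by
  set M := ⨆ x, f x with hM
  set N := ⨆ x, g x with hN
  have hfM : ∀ x, f x ≤ M := le_iSup f
  have hgN : ∀ x, g x ≤ N := le_iSup g
  rcases eq_or_ne M 0 with hM0 | hM0
  · have : ∀ x, f x = 0 := fun x => le_antisymm (hM0 ▸ hfM x) zero_le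
    simp [this]
  rcases eq_or_ne N 0 with hN0 | hN0
  · have : ∀ x, g x = 0 := fun x => le_antisymm (hN0 ▸ hgN x) zero_le
    simp [this]
  obtain ⟨c, hc0, hct, hc⟩ := exists_mul_self_eq_ennreal (M * N) (mul_ne_zero hM0 hN0)
    (ENNReal.mul_ne_top hfb hgb)
  have hcinv : c⁻¹ * c⁻¹ = M⁻¹ * N⁻¹ := by
    rw [← ENNReal.mul_inv (.inl hc0) (.inl hct), hc, ENNReal.mul_inv (.inl hM0) (.inl hfb)]
  have sup_norm : ∀ (u : ℝ → ℝ≥0∞) (m : ℝ≥0∞), m ≠ 0 → m ≠ ∞ → (⨆ x, u x) = m →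
      (∀ x, u x * m⁻¹ ≤ 1) ∧ ∀ t < (1 : ℝ), ∃ x, t < (u x * m⁻¹).toReal := by
    intro u m hm0 hmt hu
    have h1 : ∀ x, u x * m⁻¹ ≤ 1 := fun x => by
      rw [← ENNReal.mul_inv_cancel hm0 hmt]
      exact mul_le_mul_left (hu ▸ le_iSup u x) _
    refine ⟨h1, fun t ht => ?_⟩
    have h2 : (⨆ x, u x * m⁻¹) = 1 := by
      rw [← ENNReal.iSup_mul, hu, ENNReal.mul_inv_cancel hm0 hmt]
    have h3 : ENNReal.ofReal t < ⨆ x, u x * m⁻¹ := by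
      rw [h2]; exact ENNReal.ofReal_lt_one.2 ht
    obtain ⟨x, hx⟩ := lt_iSup_iff.1 h3
    rw [← ENNReal.ofReal_toReal ((h1 x).trans_lt ENNReal.one_lt_top).ne] at hx
    exact ⟨x, (ENNReal.ofReal_lt_ofReal_iff'.1 hx).1⟩
  obtain ⟨hF1, hFs⟩ := sup_norm f M hM0 hfb rfl
  obtain ⟨hG1, hGs⟩ := sup_norm g N hN0 hgb rfl
  have hFt : ∀ x, f x * M⁻¹ ≠ ∞ := fun x => ((hF1 x).trans_lt ENNReal.one_lt_top).ne
  have hGt : ∀ x, g x * N⁻¹ ≠ ∞ := fun x => ((hG1 x).trans_lt ENNReal.one_lt_top).ne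
  -- Capping at 1 makes `h` finite, so that `toReal` loses nothing. The hypothesis survives because
  -- the normalized `f` and `g` are at most 1.
  have hHt : ∀ x, min (h x * c⁻¹) 1 ≠ ∞ := fun x =>
    ((min_le_right _ _).trans_lt ENNReal.one_lt_top).ne
  have key := lintegral_add_le_of_real (f := fun x => (f x * M⁻¹).toReal)
    (g := fun x => (g x * N⁻¹).toReal) (h := fun x => (min (h x * c⁻¹) 1).toReal)
    (by fun_prop) (by fun_prop) (by fun_prop) (fun _ => ENNReal.toReal_nonneg)
    (fun _ => ENNReal.toReal_nonneg) (fun _ => ENNReal.toReal_nonneg)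
    (fun x => ENNReal.toReal_le_of_le_ofReal zero_le_one (by simpa using hF1 x))
    (fun x => ENNReal.toReal_le_of_le_ofReal zero_le_one (by simpa using hG1 x)) hFs hGs
    (fun x y => by
      rw [← ENNReal.toReal_mul, ← ENNReal.toReal_pow]
      refine ENNReal.toReal_mono (ENNReal.pow_ne_top (hHt _)) ?_
      rcases le_total (h ((x + y) / 2) * c⁻¹) 1 with h1 | h1
      · rw [min_eq_left h1, mul_pow, sq c⁻¹, hcinv]
        calc f x * M⁻¹ * (g y * N⁻¹) = (f x * g y) * (M⁻¹ * N⁻¹) := by ring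
          _ ≤ _ := mul_le_mul_left (H x y) _
      · rw [min_eq_right h1, one_pow]
        exact mul_le_one' (hF1 x) (hG1 y))
  simp only [ENNReal.ofReal_toReal (hFt _), ENNReal.ofReal_toReal (hGt _),
    ENNReal.ofReal_toReal (hHt _)] at key
  have key2 : (∫⁻ x, f x * M⁻¹) + ∫⁻ x, g x * N⁻¹ ≤ 2 * ((∫⁻ x, h x) * c⁻¹) := by
    refine key.trans (mul_le_mul_right ?_ _)
    rw [← lintegral_mul_const _ hh]
    exact lintegral_mono fun x => min_le_left _ _
  rw [lintegral_mul_const _ hf, lintegral_mul_const _ hg] at key2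
  set a := ∫⁻ x, f x
  set b := ∫⁻ x, g x
  set e := ∫⁻ x, h x
  have h4 : 4 * (a * M⁻¹) * (b * N⁻¹) ≤ (2 * (e * c⁻¹)) ^ 2 :=
    (four_mul_le_sq_add_ennreal _ _).trans (pow_le_pow_left₀ zero_le key2 2)
  have h5 : 4 * (M * N)⁻¹ * (a * b) ≤ 4 * (M * N)⁻¹ * e ^ 2 := by
    rw [ENNReal.mul_inv (.inl hM0) (.inl hfb)]
    calc 4 * (M⁻¹ * N⁻¹) * (a * b) = 4 * (a * M⁻¹) * (b * N⁻¹) := by ring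
      _ ≤ _ := h4
      _ = 4 * (c⁻¹ * c⁻¹) * e ^ 2 := by ring
      _ = _ := by rw [hcinv]
  have hMN : (M * N) ≠ ∞ := ENNReal.mul_ne_top hfb hgb
  refine (ENNReal.mul_le_mul_iff_right ?_ ?_).1 h5
  · exact mul_ne_zero (by norm_num) (ENNReal.inv_ne_zero.2 hMN)
  · exact ENNReal.mul_ne_top (by norm_num) (ENNReal.inv_ne_top.2 (mul_ne_zero hM0 hN0))

/-- One-dimensional Prékopa–Leindler inequality. -/
lemma prekopaLeindler_real {f g h : ℝ → ℝ≥0∞} (hf : Measurable f) (hg : Measurable g)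
    (hh : Measurable h) (H : ∀ x y, f x * g y ≤ h ((x + y) / 2) ^ 2) :
    (∫⁻ x, f x) * ∫⁻ x, g x ≤ (∫⁻ x, h x) ^ 2 := by
  have trunc : ∀ u : ℝ → ℝ≥0∞, Measurable u →
      (∫⁻ x, u x) = ⨆ n : ℕ, ∫⁻ x, min (u x) n := by
    intro u hu
    rw [← lintegral_iSup (fun n => hu.min measurable_const)]
    · congr with x
      rw [← inf_iSup_eq, ENNReal.iSup_natCast, inf_top_eq]
    · intro m n hmn x
      exact min_le_min_left _ (by exact_mod_cast hmn)
  have bdd : ∀ (u : ℝ → ℝ≥0∞) (n : ℕ), ⨆ x, min (u x) (n : ℝ≥0∞) ≠ ∞ := fun u n =>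
    ((iSup_le fun x => min_le_right _ _).trans_lt (ENNReal.natCast_lt_top n)).ne
  rw [trunc f hf, trunc g hg, ENNReal.iSup_mul]
  refine iSup_le fun n => ?_
  rw [ENNReal.mul_iSup]
  refine iSup_le fun m => ?_
  exact prekopaLeindler_real_of_bounded (hf.min measurable_const) (hg.min measurable_const) hh
    (bdd f n) (bdd g m) fun x y =>
      (mul_le_mul' (min_le_left _ _) (min_le_left _ _)).trans (H x y)

/-- Induction by Fubini: the slices over `a`, `b` and `(a + b) / 2` satisfy the hypothesis in
dimension `n`, and the resulting inequality is the hypothesis of the one-dimensional case for the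
marginals. -/
lemma prekopaLeindler_pi (n : ℕ) {f g h : (Fin n → ℝ) → ℝ≥0∞} (hf : Measurable f)
    (hg : Measurable g) (hh : Measurable h)
    (H : ∀ x y, f x * g y ≤ h ((1 / 2 : ℝ) • (x + y)) ^ 2) :
    (∫⁻ x, f x) * ∫⁻ x, g x ≤ (∫⁻ x, h x) ^ 2 := by
  induction n with
  | zero =>
    rw [volume_pi, Measure.pi_of_empty (x := 0)]
    simp only [lintegral_dirac]
    simpa using H 0 0
  | succ n ih =>
    have fub : ∀ u : (Fin (n + 1) → ℝ) → ℝ≥0∞, Measurable u →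
        (∫⁻ x, u x) = ∫⁻ a : ℝ, ∫⁻ z : Fin n → ℝ, u (Fin.cons a z) := by
      intro u hu
      have e := (volume_preserving_piFinSuccAbove (fun _ : Fin (n + 1) => ℝ) 0).symm
      rw [← e.lintegral_comp hu, Measure.volume_eq_prod, lintegral_prod _ (by fun_prop)]
      refine lintegral_congr fun a => lintegral_congr fun z => congrArg u ?_
      exact Fin.insertNth_zero' a z
    have cm : Measurable fun p : ℝ × (Fin n → ℝ) => (Fin.cons p.1 p.2 : Fin (n + 1) → ℝ) :=
      measurable_pi_iff.2 <| Fin.cases (by simpa using measurable_fst)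
        fun j => by simpa using! (measurable_pi_apply j).comp measurable_snd
    have cm' : ∀ a : ℝ, Measurable fun z : Fin n → ℝ => (Fin.cons a z : Fin (n + 1) → ℝ) :=
      fun a => cm.comp measurable_prodMk_left
    rw [fub f hf, fub g hg, fub h hh]
    refine prekopaLeindler_real (hf.comp cm).lintegral_prod_right'
      (hg.comp cm).lintegral_prod_right' (hh.comp cm).lintegral_prod_right' fun a b => ?_
    refine ih (hf.comp (cm' a)) (hg.comp (cm' b)) (hh.comp (cm' _)) fun x y => ?_
    refine (H _ _).trans_eq ?_
    congr 2
    funext i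
    refine Fin.cases ?_ (fun j => ?_) i
    · simp; ring
    · simp; ring

/-- The Prékopa–Leindler inequality for midpoints in Euclidean space. -/
theorem prekopaLeindler {d : ℕ} {f g h : Vec d → ℝ≥0∞} (hf : Measurable f) (hg : Measurable g)
    (hh : Measurable h) (H : ∀ x y, f x * g y ≤ h ((1 / 2 : ℝ) • (x + y)) ^ 2) :
    (∫⁻ x, f x) * ∫⁻ x, g x ≤ (∫⁻ x, h x) ^ 2 := by
  have e := PiLp.volume_preserving_toLp (Fin d)
  have m : Measurable (WithLp.toLp 2 : (Fin d → ℝ) → Vec d) := e.measurable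
  rw [← e.lintegral_comp hf, ← e.lintegral_comp hg, ← e.lintegral_comp hh]
  refine prekopaLeindler_pi d (hf.comp m) (hg.comp m) (hh.comp m) fun x y => ?_
  exact H _ _

/-! ### A Grünbaum-type inequality for cuts near the centroid -/

lemma sq_lintegral_mul_le {α : Type*} [MeasurableSpace α] (μ : Measure α) {f g : α → ℝ≥0∞}
    (hf : AEMeasurable f μ) (hg : AEMeasurable g μ) :
    (∫⁻ x, f x * g x ∂μ) ^ 2 ≤ (∫⁻ x, f x ^ 2 ∂μ) * ∫⁻ x, g x ^ 2 ∂μ := by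
  have h := ENNReal.lintegral_mul_le_Lp_mul_Lq μ Real.HolderConjugate.two_two hf hg
  have hsq : ∀ a : ℝ≥0∞, (a ^ (1 / 2 : ℝ)) ^ 2 = a := fun a => by
    rw [← ENNReal.rpow_natCast, ← ENNReal.rpow_mul]; norm_num
  refine (pow_le_pow_left₀ zero_le h 2).trans_eq ?_
  simp only [mul_pow, hsq, ENNReal.rpow_ofNat]

/-- A functional form of the log-concavity of `b ↦ volume (S ∩ {⟪·, v⟫ ≤ b})`. -/
lemma integral_tail_mul_le {d : ℕ} {S : Set (Vec d)} (hS : IsCompact S) (hc : Convex ℝ S)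
    (p v : Vec d) (t b : ℝ) :
    (∫ x in S, max (2 * t - b - ⟪x - p, v⟫_ℝ) 0) * volume.real (S ∩ {x | ⟪x - p, v⟫_ℝ ≤ b}) ≤
      2 * (∫ x in S, max (t - ⟪x - p, v⟫_ℝ) 0) * volume.real (S ∩ {x | ⟪x - p, v⟫_ℝ < t}) := by
  set u : Vec d → ℝ := fun x => ⟪x - p, v⟫_ℝ with hu
  have huc : Continuous u := by fun_prop
  have humid : ∀ x y, u ((1 / 2 : ℝ) • (x + y)) = (u x + u y) / 2 := fun x y => by
    simp only [hu, inner_sub_left, inner_smul_left, inner_add_left]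
    simp
    ring
  have hSm := hS.measurableSet
  have hSb : MeasurableSet (S ∩ {x | u x ≤ b}) :=
    hSm.inter (measurableSet_le huc.measurable measurable_const)
  have hSt : MeasurableSet (S ∩ {x | u x < t}) :=
    hSm.inter (measurableSet_lt huc.measurable measurable_const)
  have hfin : ∀ A : Set (Vec d), volume (S ∩ A) ≠ ∞ := fun A =>
    ((measure_mono inter_subset_left).trans_lt hS.measure_lt_top).ne
  have conv : ∀ w : Vec d → ℝ, Continuous w →
      ∫⁻ x, S.indicator (fun x => ENNReal.ofReal (w x)) x =
        ENNReal.ofReal (∫ x in S, max (w x) 0) := by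
    intro w hw
    rw [ofReal_integral_eq_lintegral_ofReal (f := fun x => max (w x) 0)
      ((hw.max continuous_const).continuousOn.integrableOn_compact hS)
      (.of_forall fun x => le_max_right _ _), lintegral_indicator hSm]
    simp
  have hpos : ∀ w : Vec d → ℝ, 0 ≤ ∫ x in S, max (w x) 0 := fun w =>
    integral_nonneg fun _ => le_max_right _ _
  -- For `u y ≤ b` and `z` the midpoint of `x` and `y`, `2t - b - u x ≤ 2t - u x - u y = 2 (t - u
  -- z)`; hence the square root as third function.
  have PL := prekopaLeindler (f := S.indicator fun x => ENNReal.ofReal (2 * t - b - u x))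
    (g := (S ∩ {x | u x ≤ b}).indicator fun _ => 1)
    (h := S.indicator fun x => ENNReal.ofReal (Real.sqrt (2 * (t - u x))))
    (Measurable.indicator (by fun_prop) hSm) (measurable_const.indicator hSb)
    (Measurable.indicator (by fun_prop) hSm) (by
      intro x y
      by_cases hx : x ∈ S
      · by_cases hy : y ∈ S ∩ {x | u x ≤ b}
        · have hz : (1 / 2 : ℝ) • (x + y) ∈ S := by
            rw [smul_add]
            exact hc hx hy.1 (by norm_num) (by norm_num) (by norm_num)
          rw [indicator_of_mem hx, indicator_of_mem hy, indicator_of_mem hz, mul_one,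
            ← ENNReal.ofReal_pow (Real.sqrt_nonneg _), Real.sq_sqrt', humid]
          have : u y ≤ b := hy.2
          exact ENNReal.ofReal_le_ofReal (le_max_of_le_left (by linarith))
        · simp [indicator_of_notMem hy]
      · simp [indicator_of_notMem hx])
  -- The root vanishes off `{u < t}`, so Cauchy–Schwarz against the indicator of that set removes
  -- it.
  have CS := sq_lintegral_mul_le volume
    (f := S.indicator fun x => ENNReal.ofReal (Real.sqrt (2 * (t - u x))))
    (g := (S ∩ {x | u x < t}).indicator fun _ => 1)
    (Measurable.indicator (by fun_prop) hSm).aemeasurable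
    (measurable_const.indicator hSt).aemeasurable
  have e1 : ∀ x, (S.indicator fun x => ENNReal.ofReal (Real.sqrt (2 * (t - u x)))) x *
      ((S ∩ {x | u x < t}).indicator fun _ => (1 : ℝ≥0∞)) x =
      (S.indicator fun x => ENNReal.ofReal (Real.sqrt (2 * (t - u x)))) x := by
    intro x
    by_cases hx : x ∈ S
    · by_cases hxt : u x < t
      · rw [indicator_of_mem (show x ∈ S ∩ {x | u x < t} from ⟨hx, hxt⟩), mul_one]
      · rw [indicator_of_mem hx, Real.sqrt_eq_zero_of_nonpos (by linarith)]
        simp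
    · simp [indicator_of_notMem hx]
  have e2 : ∀ x, (S.indicator fun x => ENNReal.ofReal (Real.sqrt (2 * (t - u x)))) x ^ 2 =
      S.indicator (fun x => ENNReal.ofReal (2 * (t - u x))) x := by
    intro x
    by_cases hx : x ∈ S
    · rw [indicator_of_mem hx, indicator_of_mem hx, ← ENNReal.ofReal_pow (Real.sqrt_nonneg _),
        Real.sq_sqrt', ENNReal.ofReal_max]
      simp
    · simp [indicator_of_notMem hx]
  have e3 : ∀ x, ((S ∩ {x | u x < t}).indicator fun _ => (1 : ℝ≥0∞)) x ^ 2 =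
      (S ∩ {x | u x < t}).indicator (fun _ => 1) x := by
    intro x
    by_cases hx : x ∈ S ∩ {x | u x < t}
    · simp [indicator_of_mem hx]
    · simp [indicator_of_notMem hx]
  simp only [e1, e2, e3] at CS
  have key := PL.trans CS
  rw [conv _ (by fun_prop), conv _ (by fun_prop), lintegral_indicator_const hSb,
    lintegral_indicator_const hSt, one_mul, one_mul, ← ofReal_measureReal (hfin _),
    ← ofReal_measureReal (hfin _), ← ENNReal.ofReal_mul (hpos _),
    ← ENNReal.ofReal_mul (hpos _),
    ENNReal.ofReal_le_ofReal_iff (mul_nonneg (hpos _) measureReal_nonneg)] at key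
  have e4 : (∫ x in S, max (2 * (t - u x)) 0) = 2 * ∫ x in S, max (t - u x) 0 := by
    rw [← integral_const_mul]
    congr with x
    rw [mul_max_of_nonneg _ _ (by norm_num), mul_zero]
  rw [e4] at key
  exact key

/-- Contracting a convex set towards one of its points `w`. -/
lemma pow_mul_volume_le {d : ℕ} {S : Set (Vec d)} (hS : IsCompact S) (hc : Convex ℝ S)
    {w : Vec d} (hw : w ∈ S) (p v : Vec d) (a : ℝ) {l : ℝ} (h0 : 0 ≤ l) (h1 : l ≤ 1) :
    l ^ d * volume.real (S ∩ {x | a ≤ ⟪x - p, v⟫_ℝ}) ≤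
      volume.real (S ∩ {x | (1 - l) * ⟪w - p, v⟫_ℝ + l * a ≤ ⟪x - p, v⟫_ℝ}) := by
  have h := Measure.addHaar_image_homothety (volume : Measure (Vec d)) w l
    (S ∩ {x | a ≤ ⟪x - p, v⟫_ℝ})
  rw [finrank_euclideanSpace_fin, abs_of_nonneg (pow_nonneg h0 d)] at h
  have h2 : volume.real (AffineMap.homothety w l '' (S ∩ {x | a ≤ ⟪x - p, v⟫_ℝ})) =
      l ^ d * volume.real (S ∩ {x | a ≤ ⟪x - p, v⟫_ℝ}) := by
    rw [measureReal_def, h, ENNReal.toReal_mul, ENNReal.toReal_ofReal (pow_nonneg h0 d)]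
    rfl
  rw [← h2]
  refine measureReal_mono ?_
    ((measure_mono inter_subset_left).trans_lt hS.measure_lt_top).ne
  rintro _ ⟨x, ⟨hx, hxa⟩, rfl⟩
  have e : AffineMap.homothety w l x = (1 - l) • w + l • x := by
    simp only [AffineMap.homothety_apply, vsub_eq_sub, vadd_eq_add, smul_sub, sub_smul, one_smul]
    abel
  rw [e]
  refine ⟨hc hw hx (by linarith) h0 (by ring), ?_⟩
  have hxa' : a ≤ ⟪x - p, v⟫_ℝ := hxa
  have e2 : ⟪(1 - l) • w + l • x - p, v⟫_ℝ = (1 - l) * ⟪w - p, v⟫_ℝ + l * ⟪x - p, v⟫_ℝ := by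
    simp only [inner_sub_left, inner_smul_left, inner_add_left]
    simp
    ring
  rw [mem_ofPred_eq, e2]
  gcongr

/-- A cut slightly below the centroid of a convex body removes a constant fraction of its volume,
provided that the body reaches far enough above the centroid. -/
theorem volume_div_le_volume_below {d : ℕ} (hd : 1 ≤ d) {S : Set (Vec d)} (hS : IsCompact S)
    (hc : Convex ℝ S) (hV : 0 < volume.real S) {w : Vec d} (hw : w ∈ S) (p v : Vec d)
    (hp : ∫ x in S, ⟪x - p, v⟫_ℝ = 0) {r : ℝ} (hr : 0 < r) (hwr : 20 * d * r ≤ ⟪w - p, v⟫_ℝ) :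
    volume.real S / 16 ≤ volume.real (S ∩ {x | ⟪x - p, v⟫_ℝ < -r}) := by
  by_contra! hQ
  -- The ratio `1 - 1/(2d)` keeps at least half of the volume (Bernoulli) and still lifts level `-r`
  -- to at least `9 r`, because `⟪w - p, v⟫ / (2d) ≥ 10 r`.
  have hB := pow_mul_volume_le hS hc hw p v (-r) (l := 1 - 1 / (2 * d)) (by
    have : (1 : ℝ) ≤ d := by exact_mod_cast hd
    rw [sub_nonneg, div_le_one (by positivity)]; linarith) (by
    have : (0 : ℝ) ≤ 1 / (2 * d) := by positivity
    linarith)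
  -- With `b` four times the mean of the positive part, Markov leaves at most a quarter of the
  -- volume above `b`.
  have htail := integral_tail_mul_le hS hc p v (-r)
    (4 * (∫ x in S, max ⟪x - p, v⟫_ℝ 0) / volume.real S)
  set u : Vec d → ℝ := fun x => ⟪x - p, v⟫_ℝ with hu
  have huc : Continuous u := by fun_prop
  have hSm := hS.measurableSet
  have hfin : ∀ A : Set (Vec d), volume (S ∩ A) ≠ ∞ := fun A =>
    ((measure_mono inter_subset_left).trans_lt hS.measure_lt_top).ne
  have hint : ∀ f : Vec d → ℝ, Continuous f → IntegrableOn f S := fun f hf =>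
    hf.continuousOn.integrableOn_compact hS
  have hd' : (1 : ℝ) ≤ d := by exact_mod_cast hd
  set V := volume.real S with hVdef
  set P := ∫ x in S, max (u x) 0 with hP
  set b := 4 * P / V with hb
  set Q := volume.real (S ∩ {x | u x < -r}) with hQdef
  set J := ∫ x in S, max (-r - u x) 0 with hJ
  have hJ0 : 0 ≤ J := integral_nonneg fun _ => le_max_right _ _
  have hP0 : 0 ≤ P := integral_nonneg fun _ => le_max_right _ _
  have hQ0 : 0 ≤ Q := measureReal_nonneg
  have hb0 : 0 ≤ b := by positivity
  have hbV : b * V = 4 * P := by rw [hb]; field_simp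
  have markov : ∀ a : ℝ, a * volume.real (S ∩ {x | a ≤ u x}) ≤ P := by
    intro a
    rcases lt_or_ge a 0 with ha | ha
    · exact (mul_nonpos_of_nonpos_of_nonneg ha.le measureReal_nonneg).trans hP0
    have hm : MeasurableSet {x | a ≤ u x} := measurableSet_le measurable_const huc.measurable
    have h := integral_mono (μ := volume.restrict S)
      (f := {x | a ≤ u x}.indicator fun _ => a) (g := fun x => max (u x) 0)
      ((integrable_const_iff.2 (.inr ⟨by simpa using hS.measure_lt_top⟩)).indicator hm)
      (hint _ (by fun_prop)) (fun x => by
        by_cases hx : x ∈ {x | a ≤ u x}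
        · rw [indicator_of_mem hx]; exact le_max_of_le_left hx
        · rw [indicator_of_notMem hx]; exact le_max_right _ _)
    rw [integral_indicator_const _ hm, measureReal_restrict_apply hm, smul_eq_mul, mul_comm,
      inter_comm] at h
    exact h
  -- mass above `9 r`
  have hbern : (1 / 2 : ℝ) ≤ (1 - 1 / (2 * (d : ℝ))) ^ d := by
    have h := one_add_mul_le_pow (a := -(1 / (2 * (d : ℝ)))) (by
      have : 1 / (2 * (d : ℝ)) ≤ 1 := by
        rw [div_le_one (by positivity)]; linarith
      linarith) d
    rw [← sub_eq_add_neg] at h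
    refine le_trans (le_of_eq ?_) h
    field_simp
    norm_num
  have hsplit : V = Q + volume.real (S ∩ {x | -r ≤ u x}) := by
    rw [hVdef, ← measureReal_inter_add_sdiff (s := S) (t := {x | u x < -r})
      (measurableSet_lt huc.measurable measurable_const) hS.measure_lt_top.ne]
    congr 2
    ext x
    simp
  have h9 : volume.real (S ∩ {x | (1 - (1 - 1 / (2 * (d : ℝ)))) * u w +
      (1 - 1 / (2 * (d : ℝ))) * -r ≤ u x}) ≤ volume.real (S ∩ {x | 9 * r ≤ u x}) := by
    refine measureReal_mono (inter_subset_inter_right _ fun x hx => ?_) (hfin _)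
    refine le_trans ?_ (show _ ≤ u x from hx)
    have h1 : 1 / (2 * (d : ℝ)) * (20 * d * r) = 10 * r := by field_simp; norm_num
    have h2 : 1 / (2 * (d : ℝ)) * (20 * d * r) ≤ 1 / (2 * (d : ℝ)) * u w := by gcongr
    have h3 : 0 ≤ 1 / (2 * (d : ℝ)) * r := by positivity
    generalize 1 / (2 * (d : ℝ)) = c at *
    linarith
  have hmass : 15 / 32 * V ≤ volume.real (S ∩ {x | 9 * r ≤ u x}) := by
    have h1 : 1 / 2 * volume.real (S ∩ {x | -r ≤ u x}) ≤
        (1 - 1 / (2 * (d : ℝ))) ^ d * volume.real (S ∩ {x | -r ≤ u x}) := by gcongr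
    linarith
  have hPlow : 4 * (r * V) < P := by
    have h1 := markov (9 * r)
    have h2 : 9 * r * (15 / 32 * V) ≤ 9 * r * volume.real (S ∩ {x | 9 * r ≤ u x}) := by gcongr
    have h3 : 0 < r * V := by positivity
    linarith
  -- negative part
  have hN : P ≤ r * V + J := by
    have h1 : P = ∫ x in S, max (-u x) 0 := by
      have : ∫ x in S, (max (u x) 0 - max (-u x) 0) = 0 := by
        refine Eq.trans (integral_congr_ae (.of_forall fun x => ?_)) hp
        change max (u x) 0 - max (-u x) 0 = u x
        rcases le_total (u x) 0 with h | h
        · simp [max_eq_right h, max_eq_left (neg_nonneg.2 h)]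
        · simp [max_eq_left h, max_eq_right (neg_nonpos.2 h)]
      rw [integral_sub (hint _ (by fun_prop)) (hint _ (by fun_prop))] at this
      linarith
    have h2 : r * V + J = ∫ x in S, (r + max (-r - u x) 0) := by
      rw [integral_add (hint _ (by fun_prop)) (hint _ (by fun_prop)), setIntegral_const,
        smul_eq_mul, mul_comm r]
    rw [h1, h2]
    refine setIntegral_mono (hint _ (by fun_prop)) (hint _ (by fun_prop)) fun x => ?_
    exact max_le (by linarith [le_max_left (-r - u x) 0]) (by linarith [le_max_right (-r - u x) 0])
  -- mass below `b`
  have hGb : 3 / 4 * V ≤ volume.real (S ∩ {x | u x ≤ b}) := by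
    have h1 := markov b
    have h2 : volume.real (S ∩ {x | b ≤ u x}) ≤ V / 4 := by
      have hb' : 0 < b := by
        have : 0 < r * V := by positivity
        rw [hb]; apply div_pos (by linarith) hV
      have : b * volume.real (S ∩ {x | b ≤ u x}) ≤ b * (V / 4) := by linarith
      exact le_of_mul_le_mul_left this hb'
    have h3 : V ≤ volume.real (S ∩ {x | u x ≤ b}) + volume.real (S ∩ {x | b ≤ u x}) := by
      refine le_trans (measureReal_mono ?_ ?_) (measureReal_union_le _ _)
      · intro x hx
        rcases le_total (u x) b with h | h
        · exact .inl ⟨hx, h⟩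
        · exact .inr ⟨hx, h⟩
      · rw [← inter_union_distrib_left]; exact hfin _
    linarith
  set F := ∫ x in S, max (2 * -r - b - u x) 0 with hF
  have hF0 : 0 ≤ F := integral_nonneg fun _ => le_max_right _ _
  have hFJ : F ≤ J / 6 := by
    have h1 : F * (3 / 4 * V) ≤ F * volume.real (S ∩ {x | u x ≤ b}) := by gcongr
    have h2 : 2 * J * Q ≤ 2 * J * (V / 16) := by gcongr
    have h3 : F * V ≤ J / 6 * V := by linarith
    exact le_of_mul_le_mul_right h3 hV
  -- Raising the level from `-2r - b` to `-r` adds at most `b + r` to the positive part, and only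
  -- where `u < -r`.
  have hJF : J ≤ F + (b + r) * Q := by
    have hm : MeasurableSet {x | u x < -r} := measurableSet_lt huc.measurable measurable_const
    have hi : IntegrableOn ({x | u x < -r}.indicator fun _ => b + r) S :=
      (integrable_const_iff.2 (.inr ⟨by simpa using hS.measure_lt_top⟩)).indicator hm
    have e : F + (b + r) * Q =
        ∫ x in S, (max (2 * -r - b - u x) 0 + {x | u x < -r}.indicator (fun _ => b + r) x) := by
      rw [integral_add (hint _ (by fun_prop)) hi, integral_indicator_const _ hm,
        measureReal_restrict_apply hm, smul_eq_mul, inter_comm, mul_comm (b + r)]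
    rw [e]
    refine setIntegral_mono (hint _ (by fun_prop))
      ((hint _ (by fun_prop)).add hi) fun x => ?_
    by_cases hx : x ∈ {x | u x < -r}
    · simp only [indicator_of_mem hx]
      exact max_le (by linarith [le_max_left (2 * -r - b - u x) 0])
        (by linarith [le_max_right (2 * -r - b - u x) 0])
    · simp only [indicator_of_notMem hx, add_zero]
      have : -r ≤ u x := not_lt.1 hx
      rw [max_eq_right (by linarith)]
      exact le_max_right _ _
  have hbQ : (b + r) * Q ≤ (b + r) * (V / 16) := by gcongr
  have hrV : 0 < r * V := by positivity
  -- The bounds give `5J/6 ≤ P/4 + rV/16 < 17P/64`, whereas `J ≥ P - rV > 3P/4`.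
  linarith

/-! ### Location of the centroid -/

lemma inner_centroid {d : ℕ} {S : Set (Vec d)} (hS : IsCompact S) (v : Vec d) :
    ⟪centroid S, v⟫_ℝ = (volume.real S)⁻¹ * ∫ x in S, ⟪x, v⟫_ℝ := by
  have h := integral_inner (𝕜 := ℝ) (μ := volume.restrict S) (f := fun x : Vec d => x)
    (continuous_id.continuousOn.integrableOn_compact hS) v
  rw [centroid, real_inner_smul_left, real_inner_comm, ← h]
  simp only [real_inner_comm]

lemma integral_inner_sub_centroid {d : ℕ} {S : Set (Vec d)} (hS : IsCompact S)
    (hV : 0 < volume.real S) (v : Vec d) : ∫ x in S, ⟪x - centroid S, v⟫_ℝ = 0 := by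
  have hi : ∀ f : Vec d → ℝ, Continuous f → IntegrableOn f S := fun f hf =>
    hf.continuousOn.integrableOn_compact hS
  simp only [inner_sub_left]
  rw [integral_sub (hi _ (by fun_prop)) (hi _ (by fun_prop)), setIntegral_const,
    inner_centroid hS, smul_eq_mul, mul_inv_cancel_left₀ hV.ne', sub_self]

/-- If the part of `S` above a hyperplane is mapped into `S` by the reflection in the hyperplane,
then the centroid of `S` is not above the hyperplane. -/
lemma setIntegral_inner_sub_nonpos {d : ℕ} {S : Set (Vec d)} (hS : IsCompact S) {v : Vec d}
    (hv : ‖v‖ = 1) (c : ℝ)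
    (h : ∀ x ∈ S, c < ⟪x, v⟫_ℝ → x - (2 * (⟪x, v⟫_ℝ - c)) • v ∈ S) :
    ∫ x in S, (⟪x, v⟫_ℝ - c) ≤ 0 := by
  set F : Vec d → ℝ := S.indicator fun x => ⟪x, v⟫_ℝ - c with hF
  set ρ : Vec d ≃ₗᵢ[ℝ] Vec d := (ℝ ∙ v)ᗮ.reflection with hρ
  have hR : ∀ x, ρ x + (2 * c) • v = x - (2 * (⟪x, v⟫_ℝ - c)) • v := by
    intro x
    rw [hρ, Submodule.reflection_orthogonal_apply, Submodule.reflection_singleton_apply, hv,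
      real_inner_comm]
    simp only [RCLike.ofReal_one, one_pow, div_one, ← Nat.cast_smul_eq_nsmul ℝ, smul_smul, sub_smul,
      mul_sub]
    simp
    abel
  have hFi : Integrable F := by
    rw [hF, integrable_indicator_iff hS.measurableSet]
    exact ContinuousOn.integrableOn_compact hS (by fun_prop)
  have hFi2 : Integrable fun x => F (ρ x + (2 * c) • v) :=
    (ρ.measurePreserving.integrable_comp_emb ρ.toHomeomorph.measurableEmbedding).2
      (hFi.comp_add_right ((2 * c) • v))
  have e : ∫ x, F (ρ x + (2 * c) • v) = ∫ x, F x := by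
    rw [ρ.measurePreserving.integral_comp ρ.toHomeomorph.measurableEmbedding
      (fun x => F (x + (2 * c) • v)), integral_add_right_eq_self]
  rw [← integral_indicator hS.measurableSet]
  change ∫ x, F x ≤ 0
  -- The reflection preserves volume and changes the sign of `⟪x, v⟫ - c`. If both `x` and its image
  -- lie in `S` the terms cancel; if only one does, it is not above the hyperplane.
  have key : ∫ x, (F x + F (ρ x + (2 * c) • v)) ≤ 0 := by
    refine integral_nonpos fun x => ?_
    have hu : ⟪x - (2 * (⟪x, v⟫_ℝ - c)) • v, v⟫_ℝ - c = -(⟪x, v⟫_ℝ - c) := by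
      rw [inner_sub_left, real_inner_smul_left, real_inner_self_eq_norm_sq, hv]
      ring
    have hinv : (x - (2 * (⟪x, v⟫_ℝ - c)) • v) - (2 * (-(⟪x, v⟫_ℝ - c))) • v = x := by
      rw [sub_sub, ← add_smul, ← mul_add, add_neg_cancel, mul_zero, zero_smul, sub_zero]
    simp only [Pi.zero_apply, hR]
    set x' := x - (2 * (⟪x, v⟫_ℝ - c)) • v with hx'
    have h1 := h x
    have h2 := h x'
    rw [hu, hinv] at h2
    simp only [hF]
    by_cases hx : x ∈ S <;> by_cases hxs : x' ∈ S
    · simp [hx, hxs, hu]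
    · simp only [indicator_of_mem hx, indicator_of_notMem hxs]
      by_contra! hcon
      exact hxs (h1 hx (by linarith))
    · simp only [indicator_of_notMem hx, indicator_of_mem hxs, hu]
      by_contra! hcon
      exact hx (h2 hxs (by linarith))
    · simp [hx, hxs]
  rw [integral_add hFi hFi2, e] at key
  linarith

lemma unitBall_eq_closedBall (d : ℕ) : unitBall d = Metric.closedBall 0 1 := by
  ext x; simp [unitBall]

lemma smul_unitBall {d : ℕ} {r : ℝ} (hr : 0 ≤ r) :
    r • unitBall d = Metric.closedBall (0 : Vec d) r := by
  rw [unitBall_eq_closedBall, smul_unitClosedBall, Real.norm_of_nonneg hr]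

/-- The centroid of a parallel body of a compact subset of the unit ball is in the unit ball. -/
theorem centroid_mem_unitBall {d : ℕ} {K : Set (Vec d)} (hK : IsCompact K) (hKB : K ⊆ unitBall d)
    {r : ℝ} (hr : 0 ≤ r) : centroid (K + r • unitBall d) ∈ unitBall d := by
  rw [smul_unitBall hr]
  set S := K + Metric.closedBall (0 : Vec d) r with hSdef
  have hS : IsCompact S := hK.add (isCompact_closedBall 0 r)
  set p := centroid S with hp
  change ‖p‖ ≤ 1
  rcases eq_or_ne p 0 with h0 | h0
  · simp [h0]
  have hv : ‖‖p‖⁻¹ • p‖ = 1 := norm_smul_inv_norm h0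
  set v := ‖p‖⁻¹ • p with hvdef
  have hpv : ⟪p, v⟫_ℝ = ‖p‖ := by
    rw [hvdef, real_inner_smul_right, real_inner_self_eq_norm_sq]
    field_simp
  have h := setIntegral_inner_sub_nonpos hS hv 1 (by
    rintro _ ⟨k, hk, b, hb, rfl⟩ hx
    simp only at hx ⊢
    have hk1 : ⟪k, v⟫_ℝ ≤ 1 := by
      have h1 := real_inner_le_norm k v
      have h2 : ‖k‖ ≤ 1 := hKB hk
      rw [hv, mul_one] at h1
      exact h1.trans h2
    -- The whole reflection is charged to `b`. With `s = ⟪k + b, v⟫ - 1 > 0`, its squared norm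
    -- changes by `4s (s - ⟪b, v⟫)`, which is nonpositive as `⟪k, v⟫ ≤ 1`.
    refine ⟨k, hk, b - (2 * (⟪k + b, v⟫_ℝ - 1)) • v, ?_, (add_sub_assoc _ _ _).symm⟩
    rw [mem_closedBall_zero_iff] at hb ⊢
    refine le_trans (le_of_sq_le_sq ?_ (norm_nonneg b)) hb
    rw [norm_sub_sq_real, real_inner_smul_right, norm_smul, mul_pow, hv, Real.norm_eq_abs, sq_abs]
    rw [inner_add_left] at hx ⊢
    nlinarith)
  have hi : ∀ f : Vec d → ℝ, Continuous f → IntegrableOn f S := fun f hf =>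
    hf.continuousOn.integrableOn_compact hS
  rw [integral_sub (hi _ (by fun_prop)) (hi _ (by fun_prop)), setIntegral_const, smul_eq_mul,
    mul_one] at h
  rw [← hpv, hp, inner_centroid hS]
  rcases (measureReal_nonneg (μ := volume) (s := S)).eq_or_lt with hV | hV
  -- In the null case (possible for `r = 0`) the inverse of the volume is 0 by convention.
  · rw [← hV]; simp
  · rw [inv_mul_le_iff₀ hV]; linarith

/-! ### Regret of the centroid algorithm -/

/-- The histories that can arise when `A` plays against a separation oracle for `w`. -/
inductive IsCutHistory {d : ℕ} (A : CutAlgorithm d) (w : Vec d) : CutHistory d → Prop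
  | nil : IsCutHistory A w []
  | snoc {g : CutHistory d} {v : Vec d} : IsCutHistory A w g → IsSeparatingAnswer w (A g) v →
      IsCutHistory A w (g ++ [(A g, v)])

/-- The regret accumulated in a history. -/
noncomputable def historyRegret {d : ℕ} (w : Vec d) (g : CutHistory d) : ℝ :=
  (g.map fun a => ⟪w - a.1, a.2⟫_ℝ).sum

lemma historyRegret_snoc {d : ℕ} (w p v : Vec d) (g : CutHistory d) :
    historyRegret w (g ++ [(p, v)]) = historyRegret w g + ⟪w - p, v⟫_ℝ := by
  simp [historyRegret]

lemma knowledgeSet_snoc {d : ℕ} (p v : Vec d) (g : CutHistory d) :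
    knowledgeSet (g ++ [(p, v)]) = knowledgeSet g ∩ {x | 0 ≤ ⟪x - p, v⟫_ℝ} := by
  ext x
  simp only [knowledgeSet, mem_ofPred_eq, mem_inter_iff, List.forall_mem_append,
    List.forall_mem_singleton, and_assoc]

lemma knowledgeSet_nil (d : ℕ) : knowledgeSet ([] : CutHistory d) = unitBall d := by
  ext x; simp [knowledgeSet]

lemma knowledgeSet_subset_unitBall {d : ℕ} (g : CutHistory d) : knowledgeSet g ⊆ unitBall d :=
  fun _ h => h.1

lemma isCompact_knowledgeSet {d : ℕ} (g : CutHistory d) : IsCompact (knowledgeSet g) := by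
  induction g using List.reverseRecOn with
  | nil => rw [knowledgeSet_nil, unitBall_eq_closedBall]; exact isCompact_closedBall _ _
  | append_singleton g a ih =>
    rw [knowledgeSet_snoc]
    exact ih.inter_right (isClosed_le continuous_const (by fun_prop))

lemma convex_knowledgeSet {d : ℕ} (g : CutHistory d) : Convex ℝ (knowledgeSet g) := by
  induction g using List.reverseRecOn with
  | nil => rw [knowledgeSet_nil, unitBall_eq_closedBall]; exact convex_closedBall _ _
  | append_singleton g a ih =>
    rw [knowledgeSet_snoc]
    refine ih.inter ?_
    have : {x : Vec d | 0 ≤ ⟪x - a.1, a.2⟫_ℝ} = {x | ⟪a.1, a.2⟫_ℝ ≤ innerₗ (Vec d) a.2 x} := by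
      ext x
      simp [inner_sub_left, real_inner_comm]
    rw [this]
    exact convex_halfSpace_ge (innerₗ (Vec d) a.2).isLinear _

lemma IsCutHistory.mem_knowledgeSet {d : ℕ} {A : CutAlgorithm d} {w : Vec d} {g : CutHistory d}
    (h : IsCutHistory A w g) (hw : w ∈ unitBall d) : w ∈ knowledgeSet g := by
  induction h with
  | nil => rwa [knowledgeSet_nil]
  | snoc _ hv ih =>
    rw [knowledgeSet_snoc]
    refine ⟨ih, ?_⟩
    rw [mem_ofPred_eq, inner_sub_left, sub_nonneg]
    exact hv.2

lemma centroidAlgorithm_mem_unitBall {d T : ℕ} (g : CutHistory d) :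
    centroidAlgorithm d T g ∈ unitBall d :=
  centroid_mem_unitBall (isCompact_knowledgeSet g) (knowledgeSet_subset_unitBall g) (by positivity)

/-- The region whose centroid is queried: the knowledge set, enlarged by `r`. -/
def enlargedSet {d : ℕ} (r : ℝ) (g : CutHistory d) : Set (Vec d) := knowledgeSet g + r • unitBall d

lemma isCompact_enlargedSet {d : ℕ} (r : ℝ) (g : CutHistory d) : IsCompact (enlargedSet r g) := by
  refine (isCompact_knowledgeSet g).add (IsCompact.smul r ?_)
  rw [unitBall_eq_closedBall]; exact isCompact_closedBall _ _

lemma convex_enlargedSet {d : ℕ} (r : ℝ) (g : CutHistory d) : Convex ℝ (enlargedSet r g) := by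
  refine (convex_knowledgeSet g).add (Convex.smul ?_ r)
  rw [unitBall_eq_closedBall]; exact convex_closedBall _ _

lemma enlargedSet_nil_subset {d : ℕ} {r : ℝ} (hr : 0 ≤ r) :
    enlargedSet r ([] : CutHistory d) ⊆ Metric.closedBall 0 (1 + r) := by
  rw [enlargedSet, smul_unitBall hr, knowledgeSet_nil, unitBall_eq_closedBall]
  rintro _ ⟨x, hx, y, hy, rfl⟩
  rw [mem_closedBall_zero_iff] at *
  exact (norm_add_le x y).trans (add_le_add hx hy)

lemma closedBall_subset_enlargedSet {d : ℕ} {r : ℝ} (hr : 0 ≤ r) {g : CutHistory d} {w : Vec d}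
    (hw : w ∈ knowledgeSet g) : Metric.closedBall w r ⊆ enlargedSet r g := by
  rw [enlargedSet, smul_unitBall hr]
  intro x hx
  refine ⟨w, hw, x - w, ?_, by simp⟩
  rwa [mem_closedBall_zero_iff, ← mem_closedBall_iff_norm]

lemma enlargedSet_snoc_subset {d : ℕ} {r : ℝ} (hr : 0 ≤ r) (g : CutHistory d) {p v : Vec d}
    (hv : ‖v‖ = 1) :
    enlargedSet r (g ++ [(p, v)]) ⊆ enlargedSet r g \ {x | ⟪x - p, v⟫_ℝ < -r} := by
  rw [enlargedSet, enlargedSet, smul_unitBall hr, knowledgeSet_snoc]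
  rintro _ ⟨k, ⟨hk, hkv⟩, b, hb, rfl⟩
  refine ⟨⟨k, hk, b, hb, rfl⟩, ?_⟩
  rw [mem_ofPred_eq] at hkv
  rw [mem_closedBall_zero_iff] at hb
  have h := neg_le_of_abs_le (abs_real_inner_le_norm b v)
  rw [hv, mul_one] at h
  simp only [mem_ofPred_eq, not_lt, add_sub_right_comm, inner_add_left] at hkv ⊢
  linarith

lemma volume_closedBall_eq {d : ℕ} (x : Vec d) {r : ℝ} (hr : 0 ≤ r) :
    volume.real (Metric.closedBall x r) = r ^ d * volume.real (Metric.ball (0 : Vec d) 1) := by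
  rw [measureReal_def, Measure.addHaar_closedBall _ _ hr, finrank_euclideanSpace_fin,
    ENNReal.toReal_mul, ENNReal.toReal_ofReal (pow_nonneg hr d)]
  rfl

lemma volume_unitBall_pos (d : ℕ) : 0 < volume.real (Metric.ball (0 : Vec d) 1) :=
  ENNReal.toReal_pos (Metric.measure_ball_pos _ _ one_pos).ne' measure_ball_lt_top.ne

lemma pow_mul_le_volume_enlargedSet {d : ℕ} {r : ℝ} (hr : 0 ≤ r) {g : CutHistory d} {w : Vec d}
    (hw : w ∈ knowledgeSet g) :
    r ^ d * volume.real (Metric.ball (0 : Vec d) 1) ≤ volume.real (enlargedSet r g) := by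
  rw [← volume_closedBall_eq w hr]
  exact measureReal_mono (closedBall_subset_enlargedSet hr hw)
    (isCompact_enlargedSet r g).measure_lt_top.ne

lemma volume_enlargedSet_nil_le {d : ℕ} {r : ℝ} (hr : 0 ≤ r) :
    volume.real (enlargedSet r ([] : CutHistory d)) ≤
      (1 + r) ^ d * volume.real (Metric.ball (0 : Vec d) 1) := by
  rw [← volume_closedBall_eq 0 (by linarith)]
  exact measureReal_mono (enlargedSet_nil_subset hr) measure_closedBall_lt_top.ne

/-- Each round with regret at least `20 d / T` shrinks the enlarged knowledge set by a constant
factor. -/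
lemma historyRegret_le_potential {d T : ℕ} (hd : 1 ≤ d) (hT : 0 < T) {w : Vec d}
    (hw : w ∈ unitBall d) {g : CutHistory d} (h : IsCutHistory (centroidAlgorithm d T) w g) :
    historyRegret w g ≤ g.length * (20 * d * (1 / (T : ℝ))) +
      32 * (Real.log (volume.real (enlargedSet (1 / (T : ℝ)) ([] : CutHistory d))) -
        Real.log (volume.real (enlargedSet (1 / (T : ℝ)) g))) := by
  have hr : 0 < 1 / (T : ℝ) := by positivity
  induction h with
  | nil => simp [historyRegret]
  | @snoc g v hg hv ih =>
    set p := centroidAlgorithm d T g with hp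
    have hg' := IsCutHistory.snoc hg hv
    have hwK := hg.mem_knowledgeSet hw
    have hwK' := hg'.mem_knowledgeSet hw
    have hpB : ‖p‖ ≤ 1 := centroidAlgorithm_mem_unitBall g
    set r := 1 / (T : ℝ) with hrdef
    have hV : ∀ {g' : CutHistory d}, w ∈ knowledgeSet g' → 0 < volume.real (enlargedSet r g') :=
      fun hm => (mul_pos (pow_pos hr d) (volume_unitBall_pos d)).trans_le
        (pow_mul_le_volume_enlargedSet hr.le hm)
    have hsub := enlargedSet_snoc_subset hr.le g (p := p) hv.1
    have hfin := (isCompact_enlargedSet r g).measure_lt_top (μ := volume) |>.ne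
    rw [historyRegret_snoc, List.length_append, List.length_singleton]
    push_cast
    -- A large round has regret at most 2 and lowers the log-volume by at least `1/16`, whence the
    -- weight `32`. A small round is paid for by the linear term.
    rcases le_or_gt (20 * d * r) ⟪w - p, v⟫_ℝ with hbig | hsmall
    · have hcut := volume_div_le_volume_below hd (isCompact_enlargedSet r g)
        (convex_enlargedSet r g) (hV hwK)
        (closedBall_subset_enlargedSet hr.le hwK (Metric.mem_closedBall_self hr.le)) p v
        (integral_inner_sub_centroid (isCompact_enlargedSet r g) (hV hwK) v) hr hbig
      have hm : MeasurableSet {x : Vec d | ⟪x - p, v⟫_ℝ < -r} :=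
        (isOpen_lt (by fun_prop) continuous_const).measurableSet
      have hdrop : volume.real (enlargedSet r (g ++ [(p, v)])) ≤
          15 / 16 * volume.real (enlargedSet r g) := by
        have h1 := measureReal_mono hsub
          ((measure_mono sdiff_subset).trans_lt hfin.lt_top).ne
        have h2 := measureReal_inter_add_sdiff (μ := volume) (s := enlargedSet r g) hm hfin
        linarith
      have hlog : 1 / 16 ≤ Real.log (volume.real (enlargedSet r g)) -
          Real.log (volume.real (enlargedSet r (g ++ [(p, v)]))) := by
        have h1 := Real.log_le_log (hV hwK') hdrop
        rw [Real.log_mul (by norm_num) (hV hwK).ne'] at h1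
        have h2 := Real.log_le_sub_one_of_pos (show (0 : ℝ) < 15 / 16 by norm_num)
        linarith
      have hle : ⟪w - p, v⟫_ℝ ≤ 2 := by
        have h1 := real_inner_le_norm (w - p) v
        rw [hv.1, mul_one] at h1
        have h2 := norm_sub_le w p
        have h3 : ‖w‖ ≤ 1 := hw
        linarith
      have : 0 ≤ 20 * d * r := by positivity
      linarith
    · have hmono := Real.log_le_log (hV hwK')
        (measureReal_mono (hsub.trans sdiff_subset) hfin)
      linarith

/-- Regret bound for the centroid algorithm, after at most `T` rounds. -/
theorem historyRegret_le {d T : ℕ} (hd : 1 ≤ d) (hT : 2 ≤ T) {w : Vec d} (hw : w ∈ unitBall d)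
    {g : CutHistory d} (h : IsCutHistory (centroidAlgorithm d T) w g) (hg : g.length ≤ T) :
    historyRegret w g ≤ 104 * d * Real.log T := by
  have hpot := historyRegret_le_potential hd (by omega) hw h
  have hT' : (2 : ℝ) ≤ T := by exact_mod_cast hT
  have hr : 0 < 1 / (T : ℝ) := by positivity
  have hB := volume_unitBall_pos d
  have hup := Real.log_le_log ((mul_pos (pow_pos hr d) hB).trans_le
    (pow_mul_le_volume_enlargedSet (g := []) hr.le (by rwa [knowledgeSet_nil])))
    (volume_enlargedSet_nil_le (d := d) hr.le)
  have hlow := Real.log_le_log (mul_pos (pow_pos hr d) hB)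
    (pow_mul_le_volume_enlargedSet hr.le (h.mem_knowledgeSet hw))
  rw [Real.log_mul (by positivity) hB.ne', Real.log_pow] at hup hlow
  have hlogT : Real.log (1 / (T : ℝ)) = -Real.log T := by rw [one_div, Real.log_inv]
  have hlog1 : Real.log (1 + 1 / (T : ℝ)) ≤ Real.log T := by
    refine Real.log_le_log (by positivity) ?_
    have : 1 / (T : ℝ) ≤ 1 := by rw [div_le_one (by positivity)]; linarith
    linarith
  -- The log-volume drops by at most `2 d log T`, contributing `64 d log T`; since `log T ≥ 1/2`,
  -- the remaining `20 d` is at most `40 d log T`. Together this gives `104`.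
  have hlog2 : 1 / 2 ≤ Real.log T := by
    have h1 := Real.log_le_log (by norm_num) hT'
    linarith [Real.log_two_gt_d9]
  have hlen : g.length * (20 * d * (1 / (T : ℝ))) ≤ 20 * d := by
    have h1 : (g.length : ℝ) ≤ T := by exact_mod_cast hg
    calc g.length * (20 * d * (1 / (T : ℝ))) ≤ T * (20 * d * (1 / (T : ℝ))) := by gcongr
      _ = 20 * d := by field_simp
  rw [hlogT] at hlow
  have h1 : (d : ℝ) * Real.log (1 + 1 / (T : ℝ)) ≤ d * Real.log T := by gcongr
  have h2 : (d : ℝ) * (1 / 2) ≤ d * Real.log T := by gcongr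
  linarith

lemma IsCutRun.isCutHistory {d : ℕ} {A : CutAlgorithm d} {w : Vec d} {T : ℕ} {p v : ℕ → Vec d}
    (h : IsCutRun A w T p v) {n : ℕ} (hn : n ≤ T) :
    IsCutHistory A w ((List.range n).map fun s => (p s, v s)) := by
  induction n with
  | zero => exact .nil
  | succ n ih =>
    have hv := h.answer n hn
    rw [List.range_succ, List.map_append, List.map_singleton, h.query n hn]
    rw [h.query n hn] at hv
    exact .snoc (ih (by omega)) hv

lemma cutRegret_eq_historyRegret {d : ℕ} (w : Vec d) (n : ℕ) (p v : ℕ → Vec d) :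
    cutRegret w n p v = historyRegret w ((List.range n).map fun s => (p s, v s)) := by
  induction n with
  | zero => simp [cutRegret, historyRegret]
  | succ n ih =>
    rw [List.range_succ, List.map_append, List.map_singleton, historyRegret_snoc, ← ih, cutRegret,
      Finset.sum_range_succ, cutRegret]

theorem cutRegretAtMost_centroidAlgorithm {d T : ℕ} (hd : 1 ≤ d) (hT : 2 ≤ T) :
    CutRegretAtMost (centroidAlgorithm d T) T (104 * d * Real.log T) := by
  intro w hw p v h
  refine ⟨fun t ht => ?_, ?_⟩
  · rw [h.query t ht]
    exact centroidAlgorithm_mem_unitBall _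
  · rw [cutRegret_eq_historyRegret]
    exact historyRegret_le hd hT hw (h.isCutHistory le_rfl) (by simp)

/-! ### Contextual recommendation -/

lemma simulatedHistory_snoc {d : ℕ} (A : CutAlgorithm d) (h : RecHistory d) (X : Set (Vec d))
    (x y : Vec d) :
    (y = x → simulatedHistory A (h ++ [(X, x, y)]) = simulatedHistory A h) ∧
    (y ≠ x → simulatedHistory A (h ++ [(X, x, y)]) =
      simulatedHistory A h ++ [(A (simulatedHistory A h), ‖y - x‖⁻¹ • (y - x))]) := by
  constructor <;> intro hxy <;> simp [simulatedHistory, hxy]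

/-- If `x` is a best response to `p` and `y` is one to `w`, then the normalized difference
separates `w` from `p`, and the regret of `x` is at most twice the regret of `p`. -/
lemma isSeparatingAnswer_of_bestResponses {d : ℕ} {X : Set (Vec d)} (hX : X ⊆ unitBall d)
    {w p x y : Vec d} (hx : x ∈ bestResponses X p) (hy : y ∈ bestResponses X w) (hxy : y ≠ x) :
    IsSeparatingAnswer w p (‖y - x‖⁻¹ • (y - x)) ∧
      ⟪y - x, w⟫_ℝ ≤ 2 * ⟪w - p, ‖y - x‖⁻¹ • (y - x)⟫_ℝ := by
  have h0 : y - x ≠ 0 := sub_ne_zero.2 hxy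
  have hn : 0 < ‖y - x‖ := norm_pos_iff.2 h0
  have h1 : ⟪p, y - x⟫_ℝ ≤ 0 := by
    have := hx.2 y hy.1
    rw [real_inner_comm, inner_sub_left]
    linarith
  have h2 : 0 ≤ ⟪w, y - x⟫_ℝ := by
    have := hy.2 x hx.1
    rw [real_inner_comm, inner_sub_left]
    linarith
  refine ⟨⟨norm_smul_inv_norm h0, ?_⟩, ?_⟩
  · rw [real_inner_smul_right, real_inner_smul_right]
    gcongr
    linarith
  · have h3 : ‖y - x‖ ≤ 2 := by
      have h4 : ‖y‖ ≤ 1 := hX hy.1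
      have h5 : ‖x‖ ≤ 1 := hX hx.1
      linarith [norm_sub_le y x]
    -- Since `⟪p, y - x⟫ ≤ 0`, the regret is at most `⟪w - p, y - x⟫`; normalizing then costs a
    -- factor `‖y - x‖ ≤ 2`.
    have h4 : 1 ≤ 2 * ‖y - x‖⁻¹ := by
      rw [← div_eq_mul_inv, one_le_div hn]; exact h3
    rw [real_inner_smul_right, inner_sub_left w p, real_inner_comm w (y - x)]
    nlinarith

/-- Rounds with `y = x` have zero regret and leave the simulation untouched; every other round is a
legitimate oracle answer. The simulation therefore makes at most `T` steps, and the bound for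
horizon `T` applies although its clock lags behind. -/
lemma recRun_invariant {d T : ℕ} {br : Set (Vec d) → Vec d → Vec d}
    (hbr : IsBestResponseSelector br) {A : CutAlgorithm d} (hA : ∀ g, A g ∈ unitBall d)
    {w : Vec d} {X : ℕ → Set (Vec d)} {x y : ℕ → Vec d}
    (h : IsRecRun (recommendVia br A) w T X x y) {n : ℕ} (hn : n ≤ T) :
    IsCutHistory A w (simulatedHistory A ((List.range n).map fun s => (X s, x s, y s))) ∧
    (simulatedHistory A ((List.range n).map fun s => (X s, x s, y s))).length ≤ n ∧
    recRegret w n x y ≤ 2 * historyRegret w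
      (simulatedHistory A ((List.range n).map fun s => (X s, x s, y s))) := by
  induction n with
  | zero => exact ⟨.nil, by simp [simulatedHistory], by
      simp [recRegret, historyRegret, simulatedHistory]⟩
  | succ n ih =>
    obtain ⟨ih1, ih2, ih3⟩ := ih (by omega)
    have hs := simulatedHistory_snoc A ((List.range n).map fun s => (X s, x s, y s))
      (X n) (x n) (y n)
    have hplay := h.play n hn
    rw [List.range_succ, List.map_append, List.map_singleton]
    rw [recRegret, Finset.sum_range_succ, ← recRegret]
    set g := simulatedHistory A ((List.range n).map fun s => (X s, x s, y s)) with hg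
    have hx : x n ∈ bestResponses (X n) (A g) := by
      rw [hplay]
      exact hbr _ _ ((h.offer n hn).2 _ (hA g))
    by_cases hxy : y n = x n
    · rw [hs.1 hxy, hxy, sub_self, inner_zero_left, add_zero]
      exact ⟨ih1, by omega, ih3⟩
    · rw [hs.2 hxy, historyRegret_snoc, List.length_append, List.length_singleton]
      obtain ⟨h1, h2⟩ := isSeparatingAnswer_of_bestResponses (h.offer n hn).1 hx
        (h.feedback n hn) hxy
      exact ⟨.snoc ih1 h1, by omega, by linarith⟩

theorem recRegretAtMost_recommendVia {d T : ℕ} (hd : 1 ≤ d) (hT : 2 ≤ T)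
    {br : Set (Vec d) → Vec d → Vec d} (hbr : IsBestResponseSelector br) :
    RecRegretAtMost (recommendVia br (centroidAlgorithm d T)) T (208 * d * Real.log T) := by
  intro w hw X x y h
  refine ⟨fun t ht => ?_, ?_⟩
  · rw [h.play t ht]
    exact (hbr _ _ ((h.offer t ht).2 _ (centroidAlgorithm_mem_unitBall _))).1
  · obtain ⟨h1, h2, h3⟩ := recRun_invariant hbr centroidAlgorithm_mem_unitBall h le_rfl
    linarith [historyRegret_le hd hT hw h1 h2]

end LowRegret

theorem theorem4p5 :
    ∃ C : ℝ, 0 < C ∧ ∀ d T : ℕ, 1 ≤ d → 2 ≤ T →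
      LowRegret.CutRegretAtMost (LowRegret.centroidAlgorithm d T) T (C * d * Real.log T) ∧
      ∀ br : Set (LowRegret.Vec d) → LowRegret.Vec d → LowRegret.Vec d,
        LowRegret.IsBestResponseSelector br →
          LowRegret.RecRegretAtMost (LowRegret.recommendVia br (LowRegret.centroidAlgorithm d T))
            T (C * d * Real.log T) := by
  refine ⟨208, by norm_num, fun d T hd hT => ⟨fun w hw p v h => ?_, fun br hbr =>
    LowRegret.recRegretAtMost_recommendVia hd hT hbr⟩⟩
  obtain ⟨h1, h2⟩ := LowRegret.cutRegretAtMost_centroidAlgorithm hd hT w hw p v h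
  refine ⟨h1, h2.trans ?_⟩
  have : 0 ≤ Real.log T := Real.log_natCast_nonneg T
  gcongr
  norm_num
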